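/- Let $w_1,\dots,w_n$ be positive integers with $\gcd(w_1,\dots,w_n)=1$, put $d=\sum_{i=1}^n w_i$, and suppose that $w_i\mid d$ for every $i$. For $a\in\mathbb{C}$ let $\mathcal{X}_a\subset\mathbb{P}_{w_1,\dots,w_n}$ be the hypersurface in complex weighted projective space given by $$F_a=\sum_{i=1}^n x_i^{d/w_i}+a\prod_{i=1}^n x_i .$$ A singular point of $\mathcal{X}_a$ is a point $[x]\in\mathbb{P}_{w_1,\dots,w_n}$ with $F_a(x)=0$ and $\frac{\partial F_a}{\partial x_i}(x)=0$ for all $i$, that is, a point over which the affine cone $\{F_a=0\}\subset\mathbb{C}^n\setminus\{0\}$ is singular (quotient singularities that $\mathcal{X}_a$ only inherits from the ambient space are not counted). The discriminant of the family is the set of all $a\in\mathbb{C}$ for which $\mathcal{X}_a$ has a singular point. Then the discriminant of the family is $$V\left(a^d+(-1)^{d-1}\frac{d^d}{\prod_{i=1}^n w_i^{w_i}}\right)\subset\mathbb{A}^1_{\mathbb{C}},$$ and it consists of exactly $d$ points. For each $a$ in the discriminant, $\mathcal{X}_a$ has exactly $$\frac{d^{\,n-2}}{\prod_{i=1}^n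 w_i}$$ singular points, and each of them is an ordinary double point: the $\mathbb{C}^*$-isotropy group there is trivial, so that the ambient space is smooth at the point, and in suitable local holomorphic coordinates $y_1,\dots,y_{n-1}$ centred at the point $\mathcal{X}_a$ has the local equation $\sum_{j=1}^{n-1}y_j^2=0$. Each of these singularities has Milnor number $\mu=1$ and Tjurina number $\tau=1$. -/

import Mathlib

open scoped Topology

noncomputable section

/-! ### Germs of holomorphic functions, Milnor and Tjurina numbers -/

/-- The local ring `ℂ{y - p}` of germs at `p` of holomorphic functions in the variables `y j`,
`j : ι`. -/
def HolomorphicGerm {ι : Type*} [Fintype ι] (p : ι → ℂ) :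
    Subring (Filter.Germ (𝓝 p) ℂ) where
  carrier := {g | ∃ f : (ι → ℂ) → ℂ, AnalyticAt ℂ f p ∧ g = (f : Filter.Germ (𝓝 p) ℂ)}
  mul_mem' := by
    rintro _ _ ⟨f, hf, rfl⟩ ⟨g, hg, rfl⟩
    exact ⟨f * g, hf.mul hg, rfl⟩
  one_mem' := ⟨fun _ => 1, analyticAt_const, rfl⟩
  add_mem' := by
    rintro _ _ ⟨f, hf, rfl⟩ ⟨g, hg, rfl⟩
    exact ⟨f + g, hf.add hg, rfl⟩
  zero_mem' := ⟨fun _ => 0, analyticAt_const, rfl⟩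
  neg_mem' := by
    rintro _ ⟨f, hf, rfl⟩
    exact ⟨-f, hf.neg, rfl⟩

/-- The ring of holomorphic germs is a `ℂ`-algebra through the constant functions. -/
instance holomorphicGermAlgebra {ι : Type*} [Fintype ι] (p : ι → ℂ) : Algebra ℂ (HolomorphicGerm p) :=
  RingHom.toAlgebra
    { toFun := fun c => ⟨((fun _ => c : (ι → ℂ) → ℂ) : Filter.Germ (𝓝 p) ℂ),
        fun _ => c, analyticAt_const, rfl⟩
      map_one' := rfl
      map_mul' := fun _ _ => rfl
      map_zero' := rfl
      map_add' := fun _ _ => rfl }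

/-- The ideal generated by the germs at `p` of the partial derivatives of `f`. -/
def jacobianIdeal {ι : Type*} [Fintype ι] [DecidableEq ι] (f : (ι → ℂ) → ℂ) (p : ι → ℂ) :
    Ideal (HolomorphicGerm p) :=
  Ideal.span {g | ∃ j : ι, (g : Filter.Germ (𝓝 p) ℂ) =
    ((fun y => fderiv ℂ f y (Pi.single j 1) : (ι → ℂ) → ℂ) : Filter.Germ (𝓝 p) ℂ)}

/-- The ideal generated by the germs at `p` of `f` and of its partial derivatives. -/
def tjurinaIdeal {ι : Type*} [Fintype ι] [DecidableEq ι] (f : (ι → ℂ) → ℂ) (p : ι → ℂ) :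
    Ideal (HolomorphicGerm p) :=
  Ideal.span {g | (g : Filter.Germ (𝓝 p) ℂ) = (f : Filter.Germ (𝓝 p) ℂ)} ⊔ jacobianIdeal f p

/-- The Milnor number of `f` at `p` (with value `0` if the dimension is infinite). -/
def milnorNumber {ι : Type*} [Fintype ι] [DecidableEq ι] (f : (ι → ℂ) → ℂ) (p : ι → ℂ) : ℕ :=
  Module.finrank ℂ (HolomorphicGerm p ⧸ jacobianIdeal f p)

/-- The Tjurina number of `f` at `p` (with value `0` if the dimension is infinite). -/
def tjurinaNumber {ι : Type*} [Fintype ι] [DecidableEq ι] (f : (ι → ℂ) → ℂ) (p : ι → ℂ) : ℕ :=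
  Module.finrank ℂ (HolomorphicGerm p ⧸ tjurinaIdeal f p)

/-- In suitable local holomorphic coordinates `φ` centred at `p`, the function `f` is the sum of
the squares of all the coordinates. -/
def IsLocallySumOfSquares {ι : Type*} [Fintype ι] (f : (ι → ℂ) → ℂ) (p : ι → ℂ) : Prop :=
  ∃ φ : (ι → ℂ) → (ι → ℂ), AnalyticAt ℂ φ p ∧ φ p = 0 ∧ (fderiv ℂ φ p).IsInvertible ∧
    ∀ᶠ y in 𝓝 p, f y = ∑ j, φ y j ^ 2

/-! ### Weighted projective space -/

/-- Two nonzero vectors are equivalent if they lie in one orbit of the action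
`t • x = (t ^ w i * x i)_i` of `ℂˣ`. -/
def weightedSetoid {n : ℕ} (w : Fin n → ℕ) : Setoid {x : Fin n → ℂ // x ≠ 0} where
  r x y := ∃ t : ℂˣ, ∀ i, y.1 i = (t : ℂ) ^ w i * x.1 i
  iseqv :=
    { refl := fun x => ⟨1, fun i => by simp⟩
      symm := by
        rintro x y ⟨t, h⟩
        refine ⟨t⁻¹, fun i => ?_⟩
        rw [h i, ← mul_assoc, ← mul_pow, Units.inv_mul, one_pow, one_mul]
      trans := by
        rintro x y z ⟨t, h⟩ ⟨s, k⟩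
        refine ⟨s * t, fun i => ?_⟩
        rw [k i, h i, Units.val_mul, mul_pow, mul_assoc] }

/-- The (complex points of the) weighted projective space `ℙ(w 0, …, w (n - 1))`. -/
def WeightedProjectiveSpace {n : ℕ} (w : Fin n → ℕ) : Type :=
  Quotient (weightedSetoid w)

/-- The point of weighted projective space with homogeneous coordinates `x`. -/
def WeightedProjectiveSpace.mk {n : ℕ} (w : Fin n → ℕ) (x : {x : Fin n → ℂ // x ≠ 0}) :
    WeightedProjectiveSpace w :=
  Quotient.mk (weightedSetoid w) x

/-! ### The family -/

/-- The polynomial `F_a = ∑ i, x i ^ (d / w i) + a * ∏ i, x i` with `d = ∑ i, w i`. -/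
def familyPolynomial {n : ℕ} (w : Fin n → ℕ) (a : ℂ) : MvPolynomial (Fin n) ℂ :=
  ∑ i, MvPolynomial.X i ^ ((∑ j, w j) / w i) + MvPolynomial.C a * ∏ i, MvPolynomial.X i

/-- The fibre of the family over `a`: the hypersurface `F_a = 0` in weighted projective space. -/
def fibre {n : ℕ} (w : Fin n → ℕ) (a : ℂ) : Set (WeightedProjectiveSpace w) :=
  {q | ∃ x, WeightedProjectiveSpace.mk w x = q ∧ MvPolynomial.eval x.1 (familyPolynomial w a) = 0}

/-- The singular points of the fibre over `a`: the points of the fibre over which the affine cone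
`F_a = 0`, with its vertex removed, is singular. (Quotient singularities that the fibre merely
inherits from the ambient weighted projective space do not count.) -/
def singularPoints {n : ℕ} (w : Fin n → ℕ) (a : ℂ) : Set (WeightedProjectiveSpace w) :=
  {q | q ∈ fibre w a ∧ ∃ x, WeightedProjectiveSpace.mk w x = q ∧
    ∀ i, MvPolynomial.eval x.1 (MvPolynomial.pderiv i (familyPolynomial w a)) = 0}

/-- The discriminant of the family: the parameters with a singular fibre. -/
def familyDiscriminant {n : ℕ} (w : Fin n → ℕ) : Set ℂ :=
  {a | (singularPoints w a).Nonempty}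

/-- The coordinates of `x` other than the `i`-th one. -/
def slicePoint {n : ℕ} (x : Fin n → ℂ) (i : Fin n) : {j : Fin n // j ≠ i} → ℂ :=
  fun j => x j

/-- The function `F_a` on the slice of all points whose `i`-th coordinate is that of `x`. If
`x i ≠ 0` and `x` has trivial isotropy, then near `x` this slice is a chart of weighted projective
space, and the function is the local equation of the fibre in it. -/
def localEquation {n : ℕ} (w : Fin n → ℕ) (a : ℂ) (x : Fin n → ℂ) (i : Fin n)
    (y : {j : Fin n // j ≠ i} → ℂ) : ℂ :=
  MvPolynomial.eval (fun j => if h : j = i then x i else y ⟨j, h⟩) (familyPolynomial w a)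

/-- The isotropy group of `x` in `ℂˣ` is trivial. -/
def HasTrivialIsotropy {n : ℕ} (w : Fin n → ℕ) (x : Fin n → ℂ) : Prop :=
  ∀ t : ℂˣ, (∀ i, (t : ℂ) ^ w i * x i = x i) → t = 1

/-- The fibre over `a` has an ordinary double point at `q`: its points have trivial isotropy, and in
every affine chart around `q` the local equation is a sum of squares of local coordinates. -/
def IsOrdinaryDoublePoint {n : ℕ} (w : Fin n → ℕ) (a : ℂ) (q : WeightedProjectiveSpace w) : Prop :=
  q ∈ fibre w a ∧ ∀ x, WeightedProjectiveSpace.mk w x = q → HasTrivialIsotropy w x.1 ∧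
    ∀ i, x.1 i ≠ 0 → IsLocallySumOfSquares (localEquation w a x.1 i) (slicePoint x.1 i)

/-- The fibre over `a` has Milnor number `m` at `q`, computed in every affine chart. -/
def HasMilnorNumber {n : ℕ} (w : Fin n → ℕ) (a : ℂ) (q : WeightedProjectiveSpace w) (m : ℕ) :
    Prop :=
  ∀ x, WeightedProjectiveSpace.mk w x = q → ∀ i, x.1 i ≠ 0 →
    milnorNumber (localEquation w a x.1 i) (slicePoint x.1 i) = m

/-- The fibre over `a` has Tjurina number `m` at `q`, computed in every affine chart. -/
def HasTjurinaNumber {n : ℕ} (w : Fin n → ℕ) (a : ℂ) (q : WeightedProjectiveSpace w) (m : ℕ) :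
    Prop :=
  ∀ x, WeightedProjectiveSpace.mk w x = q → ∀ i, x.1 i ≠ 0 →
    tjurinaNumber (localEquation w a x.1 i) (slicePoint x.1 i) = m

end

/-! Write `e i = d / w i`. The proof replaces the partial derivatives of `F_a` by the logarithmic
equations `e i * x i ^ e i + a * ∏ x = 0` (`IsCritical`). For `x ≠ 0` these force every coordinate
to be nonzero, so they are equivalent to the vanishing of the gradient; since `∑ 1 / e i = ∑ w i / d
= 1`, they also imply `F_a x = 0`.

Discriminant: the equations read `x i ^ e i = -(w i / d) * a * ∏ x`. Raising them to the powers `w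
i` and multiplying, `(∏ x) ^ d` cancels and leaves a condition on `a ^ d`. Conversely, under that
condition one looks for a solution with `∏ x = 1`: roots of `-(w i / d) * a` have a product which is
a `d`-th root of unity, and roots of unity of orders dividing `e i` correct it, because `gcd w = 1`
(`range_rootsProd`).

Counting: up to the weighted action, any two solutions differ by a tuple of `e i`-th roots of unity
with product 1. There are `∏ e i / d` such tuples, and two of them give the same point exactly when
they differ by some `(t ^ w i)` with `t ^ d = 1`. This leaves `∏ e i / d ^ 2` points.

Local structure: in the slice `x i = const` the Hessian is nondegenerate because `∑ 1 / e j` over `j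
≠ i` is `1 - w i / d ≠ 1`. The holomorphic Morse lemma gives the normal form, and the same
nondegeneracy makes the Jacobian ideal maximal, so both local numbers are 1. -/

/-! ### The holomorphic Morse lemma -/

/-- **Hadamard's lemma**, analytic version. -/
theorem AnalyticAt.exists_eq_add_apply_sub {E F : Type*} [NormedAddCommGroup E] [NormedSpace ℂ E]
    [NormedAddCommGroup F] [NormedSpace ℂ F] [CompleteSpace F] {g : E → F} {p : E}
    (hg : AnalyticAt ℂ g p) :
    ∃ G : E → E →L[ℂ] F, AnalyticAt ℂ G p ∧ ∀ᶠ y in 𝓝 p, g y = g p + G y (y - p) := by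
  obtain ⟨P, r, hP⟩ := hg
  have hpos : 0 < P.shift.radius := by
    rw [P.radius_shift]
    exact hP.r_pos.trans_le hP.r_le
  -- Shifting the power series drops its constant term and frees the last argument of every other
  -- term; that argument receives the factor `y - p`.
  refine ⟨fun y => P.shift.sum (y - p), ?_, ?_⟩
  · have h : AnalyticAt ℂ P.shift.sum (p - p) := by
      rw [sub_self]
      exact (P.shift.hasFPowerSeriesOnBall hpos).analyticAt
    exact h.comp (f := fun y => y - p) (analyticAt_id.sub analyticAt_const)
  · filter_upwards [Metric.eball_mem_nhds p hP.r_pos] with y hy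
    have hy' : y - p ∈ Metric.eball (0 : E) r := by
      simpa [edist_eq_enorm_sub] using hy
    have h1 := hP.hasSum hy'
    rw [add_sub_cancel] at h1
    have h2 : HasSum (fun n => P.shift n fun _ => y - p) (P.shift.sum (y - p)) :=
      P.shift.hasSum (by
        rw [P.radius_shift]
        exact Metric.eball_subset_eball hP.r_le hy')
    have h3 := h2.mapL (ContinuousLinearMap.apply ℂ F (y - p))
    have h4 := (hasSum_nat_add_iff' 1).2 h1
    have h5 : (fun n => P (n + 1) fun _ => y - p) =
        fun n => (ContinuousLinearMap.apply ℂ F (y - p)) (P.shift n fun _ => y - p) := by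
      funext n
      simp only [FormalMultilinearSeries.shift, ContinuousLinearMap.apply_apply,
        ContinuousMultilinearMap.curryRight_apply]
      congr 1
      funext i
      refine Fin.lastCases ?_ (fun j => ?_) i <;> simp
    rw [h5] at h4
    have h6 := h4.unique h3
    simp only [Finset.range_one, Finset.sum_singleton, ContinuousLinearMap.apply_apply] at h6
    rw [← h6, ← hP.coeff_zero (fun _ => y - p)]
    simp

/-- An analytic square root near the unit of a Banach algebra, locally unique. -/
theorem exists_analyticAt_sqrt (A : Type*) [NormedRing A] [NormedAlgebra ℂ A] [CompleteSpace A] :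
    ∃ s : A → A, AnalyticAt ℂ s 1 ∧ s 1 = 1 ∧ (∀ᶠ M in 𝓝 (1 : A), s M * s M = M) ∧
      ∀ᶠ X in 𝓝 (1 : A), s (X * X) = X := by
  -- Squaring has derivative `2 • id` at `1`, so the inverse function theorem applies; its left
  -- inverse property is the local uniqueness.
  have hf : ContDiffAt ℂ ⊤ (fun X : A => X * X) 1 := by fun_prop
  let e : A ≃L[ℂ] A := ContinuousLinearEquiv.smulLeft (Units.mk0 (2 : ℂ) two_ne_zero)
  have hf' : HasFDerivAt (fun X : A => X * X) (e : A →L[ℂ] A) 1 := by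
    have := (hasFDerivAt_id (𝕜 := ℂ) (1 : A)).mul' (hasFDerivAt_id (𝕜 := ℂ) (1 : A))
    refine this.congr_fderiv ?_
    ext X
    simp [e, two_smul]
  have hs := hf.hasStrictFDerivAt' hf' (by simp)
  have h1 := hf.to_localInverse hf' (by simp)
  have h2 := hs.localInverse_apply_image
  have h3 := hs.eventually_right_inverse
  simp only [mul_one] at h1 h2 h3
  exact ⟨_, h1.analyticAt, h2, h3, hs.eventually_left_inverse⟩

theorem AnalyticAt.clm_apply {E F G : Type*} [NormedAddCommGroup E] [NormedSpace ℂ E]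
    [NormedAddCommGroup F] [NormedSpace ℂ F] [NormedAddCommGroup G] [NormedSpace ℂ G]
    {c : E → F →L[ℂ] G} {u : E → F} {p : E} (hc : AnalyticAt ℂ c p) (hu : AnalyticAt ℂ u p) :
    AnalyticAt ℂ (fun y => c y (u y)) p :=
  ((ContinuousLinearMap.id ℂ (F →L[ℂ] G)).analyticAt_bilinear (c p, u p)).comp₂ hc hu

theorem AnalyticAt.clm_flip {E F G H : Type*} [NormedAddCommGroup E] [NormedSpace ℂ E]
    [NormedAddCommGroup F] [NormedSpace ℂ F] [NormedAddCommGroup G] [NormedSpace ℂ G]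
    [NormedAddCommGroup H] [NormedSpace ℂ H]
    {c : E → F →L[ℂ] G →L[ℂ] H} {p : E} (hc : AnalyticAt ℂ c p) :
    AnalyticAt ℂ (fun y => (c y).flip) p := by
  let T : (F →L[ℂ] G →L[ℂ] H) →L[ℂ] (G →L[ℂ] F →L[ℂ] H) :=
    (ContinuousLinearMap.flipₗᵢ ℂ F G H).toContinuousLinearEquiv.toContinuousLinearMap
  exact (ContinuousLinearMap.analyticAt (F := G →L[ℂ] F →L[ℂ] H) T _).comp hc

theorem AnalyticAt.smul_left {E F : Type*} [NormedAddCommGroup E] [NormedSpace ℂ E]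
    [NormedAddCommGroup F] [NormedSpace ℂ F] {g : E → F} {p : E} (hg : AnalyticAt ℂ g p) (c : ℂ) :
    AnalyticAt ℂ (fun y => c • g y) p :=
  analyticAt_const.smul hg

/-- A holomorphic function vanishing to second order is a symmetric quadratic form with holomorphic
coefficients. -/
theorem AnalyticAt.exists_eq_quadratic {E : Type*} [NormedAddCommGroup E] [NormedSpace ℂ E]
    {f : E → ℂ} {p : E} (hf : AnalyticAt ℂ f p) (h0 : f p = 0) (h1 : fderiv ℂ f p = 0) :
    ∃ h : E → E →L[ℂ] E →L[ℂ] ℂ, AnalyticAt ℂ h p ∧ (∀ y u v, h y u v = h y v u) ∧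
      ∀ᶠ y in 𝓝 p, f y = h y (y - p) (y - p) := by
  obtain ⟨G, hG, hfG⟩ := hf.exists_eq_add_apply_sub
  have hGp : G p = 0 := by
    have h2 : HasFDerivAt (fun y => f p + G y (y - p)) (G p) p := by
      have := (hG.differentiableAt.hasFDerivAt.clm_apply
        ((hasFDerivAt_id (𝕜 := ℂ) p).sub_const p)).const_add (f p)
      refine this.congr_fderiv ?_
      ext u
      simp
    rw [← h1, ((Filter.EventuallyEq.fderiv_eq hfG).trans h2.fderiv)]
  obtain ⟨H, hH, hGH⟩ := hG.exists_eq_add_apply_sub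
  -- Hadamard's lemma, applied twice, gives a bilinear form `H y`; symmetrising does not change its
  -- values on the diagonal.
  refine ⟨fun y => (2⁻¹ : ℂ) • (H y + (H y).flip), ?_, ?_, ?_⟩
  · exact (hH.add hH.clm_flip).smul_left _
  · intro y u v
    simp [add_comm]
  · filter_upwards [hfG, hGH] with y h2 h3
    rw [h2, h3, h0, hGp]
    simp
    ring

/-- Terms that differentiate the coefficients `h` keep a factor `y - p` and do not contribute at
`p`. This transfers nondegeneracy from the Hessian to `h p`. -/
theorem fderiv_fderiv_quadratic {E : Type*} [NormedAddCommGroup E] [NormedSpace ℂ E]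
    {f : E → ℂ} {p : E} {h : E → E →L[ℂ] E →L[ℂ] ℂ} (hh : AnalyticAt ℂ h p)
    (hsymm : ∀ y u v, h y u v = h y v u) (hf : ∀ᶠ y in 𝓝 p, f y = h y (y - p) (y - p)) :
    fderiv ℂ (fderiv ℂ f) p = (2 : ℂ) • h p := by
  -- The term `Dh_y(u)(y - p, y - p)` of the first derivative is written as `K y (y - p) u` with `K
  -- p = 0`, so it vanishes to second order.
  let K : E → E →L[ℂ] E →L[ℂ] ℂ := fun y => ((fderiv ℂ h y).flip (y - p)).flip
  have hKd : DifferentiableAt ℂ K p :=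
    (hh.fderiv.clm_flip.clm_apply (analyticAt_id.sub analyticAt_const)).clm_flip.differentiableAt
  have hKp : K p = 0 := by
    ext
    simp [K]
  have hf' : fderiv ℂ f =ᶠ[𝓝 p] fun y => (2 : ℂ) • h y (y - p) + K y (y - p) := by
    have hev : ∀ᶠ y in 𝓝 p, AnalyticAt ℂ h y := hh.eventually_analyticAt
    filter_upwards [hf.eventually_nhds, hev] with y h1 h2
    rw [Filter.EventuallyEq.fderiv_eq h1]
    have hid : HasFDerivAt (fun y => y - p) (ContinuousLinearMap.id ℂ E) y :=
      (hasFDerivAt_id (𝕜 := ℂ) y).sub_const p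
    rw [((h2.differentiableAt.hasFDerivAt.clm_apply hid).clm_apply hid).fderiv]
    ext u
    simp [K, hsymm y u]
    ring
  rw [hf'.fderiv_eq]
  have hid : HasFDerivAt (fun y => y - p) (ContinuousLinearMap.id ℂ E) p :=
    (hasFDerivAt_id (𝕜 := ℂ) p).sub_const p
  have h1 := ((hh.differentiableAt.hasFDerivAt.clm_apply hid).const_smul (2 : ℂ)).add
    (hKd.hasFDerivAt.clm_apply hid)
  refine h1.fderiv.trans ?_
  ext u v
  simp [hKp]

theorem finrank_continuousLinearMap_dual (E : Type*) [NormedAddCommGroup E] [NormedSpace ℂ E]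
    [FiniteDimensional ℂ E] : Module.finrank ℂ (E →L[ℂ] ℂ) = Module.finrank ℂ E := by
  rw [← Subspace.dual_finrank_eq (K := ℂ) (V := E)]
  exact (LinearMap.toContinuousLinearMap (𝕜 := ℂ) (E := E) (F' := ℂ)).finrank_eq.symm

/-- A nondegenerate symmetric bilinear form is the sum of squares in suitable coordinates. -/
theorem exists_sum_sq_eq {ι : Type*} [Fintype ι]
    (B : (ι → ℂ) →L[ℂ] (ι → ℂ) →L[ℂ] ℂ) (hsymm : ∀ u v, B u v = B v u)
    (hB : Function.Injective B) :
    ∃ T : (ι → ℂ) ≃L[ℂ] (ι → ℂ), ∀ u, B u u = ∑ j, T u j ^ 2 := by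
  let B' : LinearMap.BilinForm ℂ (ι → ℂ) := ContinuousLinearMap.toLinearMap₁₂ B
  have hB' : (QuadraticMap.associated (R := ℂ) (LinearMap.BilinMap.toQuadraticMap B')).SeparatingLeft := by
    have := QuadraticMap.associated_left_inverse (S := ℂ) (B₁ := B') (fun x y => hsymm x y)
    rw [this]
    intro x hx
    apply hB
    ext1 y
    exact (hx y).trans (by simp)
  obtain ⟨e⟩ := QuadraticForm.equivalent_weightedSumSquares_of_isAlgClosed _ hB'
  let r : ι ≃ Fin (Module.finrank ℂ (ι → ℂ)) :=
    Fintype.equivFinOfCardEq (Module.finrank_fintype_fun_eq_card ℂ).symm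
  refine ⟨(e.toLinearEquiv.trans (LinearEquiv.funCongrLeft ℂ ℂ r)).toContinuousLinearEquiv,
    fun u => ?_⟩
  have h1 := e.map_app u
  rw [QuadraticMap.weightedSumSquares_apply] at h1
  have h2 : B u u = LinearMap.BilinMap.toQuadraticMap B' u := rfl
  rw [h2, ← h1, ← r.sum_comp]
  refine Finset.sum_congr rfl fun j _ => ?_
  simp [sq, LinearEquiv.funCongrLeft, LinearMap.funLeft]

/-- The **holomorphic Morse lemma**. -/
theorem isLocallySumOfSquares_of_nondegenerate {ι : Type*} [Fintype ι] {f : (ι → ℂ) → ℂ}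
    {p : ι → ℂ} (hf : AnalyticAt ℂ f p) (h0 : f p = 0) (h1 : fderiv ℂ f p = 0)
    (h2 : Function.Injective (fderiv ℂ (fderiv ℂ f) p)) : IsLocallySumOfSquares f p := by
  obtain ⟨h, hh, hsymm, hfh⟩ := hf.exists_eq_quadratic h0 h1
  have hBinj : Function.Injective (h p) := by
    intro u v huv
    apply h2
    rw [fderiv_fderiv_quadratic hh hsymm hfh]
    simp [huv]
  obtain ⟨T, hT⟩ := exists_sum_sq_eq (h p) (hsymm p) hBinj
  let Be : (ι → ℂ) ≃L[ℂ] ((ι → ℂ) →L[ℂ] ℂ) :=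
    (LinearEquiv.ofInjectiveOfFinrankEq (h p).toLinearMap hBinj
      (finrank_continuousLinearMap_dual _).symm).toContinuousLinearEquiv
  have hBe : ∀ u, Be u = h p u := fun u => rfl
  -- With `B = h p`, the operator `M y` satisfies `h y u v = B (M y u) v` and `M p = 1`. If its
  -- square root `S` is `B`-self-adjoint, then `h y u u = B (S u) (S u)`, and `y ↦ S (y - p)`
  -- straightens `f` to the constant form `B`.
  let M : (ι → ℂ) → ((ι → ℂ) →L[ℂ] (ι → ℂ)) := fun y => Be.symm.toContinuousLinearMap ∘L h y
  have hM : AnalyticAt ℂ M p := by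
    exact ((ContinuousLinearMap.compL ℂ (ι → ℂ) ((ι → ℂ) →L[ℂ] ℂ) (ι → ℂ)
      Be.symm.toContinuousLinearMap).analyticAt _).comp hh
  have hMB : ∀ y u, h p (M y u) = h y u := fun y u => by
    rw [← hBe]
    simp [M]
  have hMp : M p = 1 := by
    ext1 u
    apply hBinj
    rw [hMB]
    rfl
  obtain ⟨s, hs, hs1, hsq, hsu⟩ := exists_analyticAt_sqrt ((ι → ℂ) →L[ℂ] (ι → ℂ))
  have hC : AnalyticAt ℂ (fun y => s (M y)) p := by
    have hs' : AnalyticAt ℂ s (M p) := by rwa [hMp]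
    exact hs'.comp hM
  -- `σ` is the adjoint for `B`. Since `h y` is symmetric, `σ` fixes `M y`, so `σ (s (M y))` is
  -- another square root of `M y` close to `1`; by local uniqueness it equals `s (M y)`.
  let σ : ((ι → ℂ) →L[ℂ] (ι → ℂ)) → ((ι → ℂ) →L[ℂ] (ι → ℂ)) := fun X =>
    Be.symm.toContinuousLinearMap ∘L
      ((ContinuousLinearMap.compL ℂ (ι → ℂ) (ι → ℂ) ℂ).flip X ∘L Be.toContinuousLinearMap)
  have hσ : Continuous σ := by fun_prop
  have hσB : ∀ X u v, h p (σ X u) v = h p u (X v) := fun X u v => by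
    rw [← hBe (σ X u)]
    have : Be (σ X u) = (Be u) ∘L X := Be.apply_symm_apply _
    rw [this]
    rfl
  have hσ1 : σ 1 = 1 := by
    ext1 u
    apply hBinj
    ext1 v
    rw [hσB]
    rfl
  have hσmul : ∀ X, σ X * σ X = σ (X * X) := fun X => by
    ext1 u
    apply hBinj
    ext1 v
    rw [mul_apply_eq_comp, hσB, hσB, hσB]
    rfl
  have hσM : ∀ y, σ (M y) = M y := fun y => by
    ext1 u
    apply hBinj
    ext1 v
    rw [hσB, hsymm, hMB, hMB, hsymm]
  have hM1 : Filter.Tendsto M (𝓝 p) (𝓝 1) := by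
    rw [← hMp]
    exact hM.continuousAt
  have hσC : Filter.Tendsto (fun y => σ (s (M y))) (𝓝 p) (𝓝 1) := by
    have := (hσ.continuousAt.comp (f := fun y => s (M y)) hC.continuousAt).tendsto
    simpa [Function.comp_def, hMp, hs1, hσ1] using this
  refine ⟨fun y => T (s (M y) (y - p)), ?_, by simp, ?_, ?_⟩
  · exact (T.toContinuousLinearMap.analyticAt _).comp
      (hC.clm_apply (analyticAt_id.sub analyticAt_const))
  · refine ⟨T, ?_⟩
    have hd := (hC.differentiableAt.hasFDerivAt.clm_apply
      ((hasFDerivAt_id (𝕜 := ℂ) p).sub_const p))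
    have := (T.toContinuousLinearMap.hasFDerivAt.comp p hd).fderiv
    refine Eq.trans ?_ this.symm
    ext u
    simp [hMp, hs1]
  · filter_upwards [hfh, hM1.eventually hsq, hσC.eventually hsu] with y h3 h4 h5
    rw [h3, ← hT, ← hMB]
    rw [hσmul, h4, hσM] at h5
    nth_rewrite 1 [← h4]
    nth_rewrite 1 [h5]
    rw [mul_apply_eq_comp, hσB]

/-! ### Milnor and Tjurina numbers of nondegenerate critical points -/

noncomputable section

/-- If the Hessian of `f` at `p` is nondegenerate, then every holomorphic function vanishing at `p`
is near `p` a combination of the partial derivatives of `f`. -/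
theorem exists_eq_sum_mul_partialDeriv {ι : Type*} [Fintype ι] [DecidableEq ι] {f φ : (ι → ℂ) → ℂ}
    {p : ι → ℂ} (hf : AnalyticAt ℂ f p) (h1 : fderiv ℂ f p = 0)
    (h2 : Function.Injective (fderiv ℂ (fderiv ℂ f) p)) (hφ : AnalyticAt ℂ φ p) (h0 : φ p = 0) :
    ∃ c : ι → (ι → ℂ) → ℂ, (∀ j, AnalyticAt ℂ (c j) p) ∧
      ∀ᶠ y in 𝓝 p, φ y = ∑ j, c j y * fderiv ℂ f y (Pi.single j 1) := by
  obtain ⟨Γ, hΓ, hφΓ⟩ := hφ.exists_eq_add_apply_sub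
  obtain ⟨A, hA, hfA⟩ := hf.fderiv.exists_eq_add_apply_sub
  have hAp : A p = fderiv ℂ (fderiv ℂ f) p := by
    have h3 : HasFDerivAt (fun y => fderiv ℂ f p + A y (y - p)) (A p) p := by
      have := (hA.differentiableAt.hasFDerivAt.clm_apply
        ((hasFDerivAt_id (𝕜 := ℂ) p).sub_const p)).const_add (fderiv ℂ f p)
      refine this.congr_fderiv ?_
      ext u
      simp
    rw [Filter.EventuallyEq.fderiv_eq hfA, h3.fderiv]
  let Be : (ι → ℂ) ≃L[ℂ] ((ι → ℂ) →L[ℂ] ℂ) :=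
    (LinearEquiv.ofInjectiveOfFinrankEq (fderiv ℂ (fderiv ℂ f) p).toLinearMap h2
      (finrank_continuousLinearMap_dual _).symm).toContinuousLinearEquiv
  have hBe : (Be : (ι → ℂ) →L[ℂ] ((ι → ℂ) →L[ℂ] ℂ)) = A p := hAp ▸ rfl
  have hinv : AnalyticAt ℂ (fun y => (A y).inverse) p := by
    have h3 : AnalyticAt ℂ ContinuousLinearMap.inverse (A p) := by
      rw [← hBe]
      exact (contDiffAt_map_inverse (n := ⊤) Be).analyticAt
    exact h3.comp hA
  -- Near `p`, `fderiv ℂ f y = A y (y - p)` with `A p` the Hessian. Solving for `y - p` and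
  -- substituting into `φ y = Γ y (y - p)` gives these coefficients.
  refine ⟨fun j y => Γ y ((A y).inverse (ContinuousLinearMap.proj j)), fun j => ?_, ?_⟩
  · exact hΓ.clm_apply (hinv.clm_apply analyticAt_const)
  -- `ContinuousLinearMap.inverse` takes the default value 0 off the invertible maps; these form an
  -- open set, so near `p` it is the true inverse.
  · have hev : ∀ᶠ y in 𝓝 p, A y ∈ Set.range
        ((↑) : ((ι → ℂ) ≃L[ℂ] ((ι → ℂ) →L[ℂ] ℂ)) → (ι → ℂ) →L[ℂ] ((ι → ℂ) →L[ℂ] ℂ)) := by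
      refine hA.continuousAt.eventually_mem ?_
      rw [← hBe]
      exact Be.nhds
    filter_upwards [hφΓ, hfA, hev] with y h3 h4 ⟨e, he⟩
    rw [h0, zero_add] at h3
    rw [h1, zero_add] at h4
    have h5 : y - p = (A y).inverse (fderiv ℂ f y) := by
      rw [h4, ← he, ContinuousLinearMap.inverse_equiv]
      simp
    have h6 : fderiv ℂ f y = ∑ j, fderiv ℂ f y (Pi.single j 1) •
        (ContinuousLinearMap.proj j : (ι → ℂ) →L[ℂ] ℂ) := by
      ext u
      simp only [sum_apply, smul_apply,
        ContinuousLinearMap.proj_apply, smul_eq_mul]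
      conv_lhs => rw [← Finset.univ_sum_single u, map_sum]
      refine Finset.sum_congr rfl fun j _ => ?_
      rw [mul_comm, ← smul_eq_mul, ← map_smul, ← Pi.single_smul, smul_eq_mul, mul_one]
    rw [h3, h5]
    conv_lhs => rw [h6, map_sum, map_sum]
    refine Finset.sum_congr rfl fun j _ => ?_
    rw [map_smul, map_smul, smul_eq_mul, mul_comm]

/-- Evaluation of holomorphic germs at the base point. -/
def HolomorphicGerm.eval {ι : Type*} [Fintype ι] (p : ι → ℂ) : HolomorphicGerm p →ₐ[ℂ] ℂ :=
  { Filter.Germ.valueRingHom.comp (HolomorphicGerm p).subtype with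
    commutes' := fun _ => rfl }

theorem HolomorphicGerm.eval_apply {ι : Type*} [Fintype ι] {p : ι → ℂ} {g : HolomorphicGerm p}
    {f : (ι → ℂ) → ℂ} (h : (g : Filter.Germ (𝓝 p) ℂ) = (f : Filter.Germ (𝓝 p) ℂ)) :
    HolomorphicGerm.eval p g = f p := by
  change Filter.Germ.value (g : Filter.Germ (𝓝 p) ℂ) = f p
  rw [h]
  rfl

theorem HolomorphicGerm.finrank_quotient_ker_eval {ι : Type*} [Fintype ι] (p : ι → ℂ) :
    Module.finrank ℂ (HolomorphicGerm p ⧸ RingHom.ker (HolomorphicGerm.eval p)) = 1 := by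
  have hsurj : Function.Surjective (HolomorphicGerm.eval p) := fun c =>
    ⟨algebraMap ℂ _ c, (HolomorphicGerm.eval p).commutes c⟩
  rw [(Ideal.quotientKerAlgEquivOfSurjective hsurj).toLinearEquiv.finrank_eq, Module.finrank_self]

section

variable {ι : Type*} [Fintype ι] [DecidableEq ι] {f : (ι → ℂ) → ℂ} {p : ι → ℂ}

/-- The partial derivatives vanish at `p`, and by nondegeneracy they generate every germ vanishing
there. The quotient is therefore the residue field `ℂ`. -/
theorem jacobianIdeal_eq_ker_eval (hf : AnalyticAt ℂ f p) (h1 : fderiv ℂ f p = 0)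
    (h2 : Function.Injective (fderiv ℂ (fderiv ℂ f) p)) :
    jacobianIdeal f p = RingHom.ker (HolomorphicGerm.eval p) := by
  apply le_antisymm
  · refine Ideal.span_le.2 ?_
    rintro g ⟨j, hj⟩
    change HolomorphicGerm.eval p g = 0
    rw [HolomorphicGerm.eval_apply hj, h1]
    rfl
  · rintro ⟨_, φ, hφ, rfl⟩ hg
    have h0 : φ p = 0 := hg
    obtain ⟨c, hc, hφc⟩ := exists_eq_sum_mul_partialDeriv hf h1 h2 hφ h0
    have hd : ∀ j, AnalyticAt ℂ (fun y => fderiv ℂ f y (Pi.single j 1)) p := fun j =>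
      hf.fderiv.clm_apply analyticAt_const
    let C : ι → HolomorphicGerm p := fun j => ⟨_, c j, hc j, rfl⟩
    let D : ι → HolomorphicGerm p := fun j => ⟨_, _, hd j, rfl⟩
    have hsum : (⟨_, φ, hφ, rfl⟩ : HolomorphicGerm p) = ∑ j, C j * D j := by
      apply Subtype.ext
      rw [AddSubmonoidClass.coe_finsetSum]
      have h3 : ∀ j, ((C j * D j : HolomorphicGerm p) : Filter.Germ (𝓝 p) ℂ) =
          Filter.Germ.coeRingHom (𝓝 p) (fun y => c j y * fderiv ℂ f y (Pi.single j 1)) :=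
        fun j => rfl
      simp only [h3]
      rw [← map_sum]
      refine Filter.Germ.coe_eq.2 ?_
      filter_upwards [hφc] with y hy
      rw [hy, Finset.sum_apply]
    rw [hsum]
    exact Ideal.sum_mem _ fun j _ => Ideal.mul_mem_left _ _ (Ideal.subset_span ⟨j, rfl⟩)

theorem milnorNumber_eq_one (hf : AnalyticAt ℂ f p) (h1 : fderiv ℂ f p = 0)
    (h2 : Function.Injective (fderiv ℂ (fderiv ℂ f) p)) : milnorNumber f p = 1 := by
  rw [milnorNumber, jacobianIdeal_eq_ker_eval hf h1 h2]
  exact HolomorphicGerm.finrank_quotient_ker_eval p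

theorem tjurinaNumber_eq_one (hf : AnalyticAt ℂ f p) (h0 : f p = 0) (h1 : fderiv ℂ f p = 0)
    (h2 : Function.Injective (fderiv ℂ (fderiv ℂ f) p)) : tjurinaNumber f p = 1 := by
  have : tjurinaIdeal f p = RingHom.ker (HolomorphicGerm.eval p) := by
    rw [tjurinaIdeal, jacobianIdeal_eq_ker_eval hf h1 h2, sup_eq_right]
    refine Ideal.span_le.2 fun g hg => ?_
    change HolomorphicGerm.eval p g = 0
    rw [HolomorphicGerm.eval_apply hg, h0]
  rw [tjurinaNumber, this]
  exact HolomorphicGerm.finrank_quotient_ker_eval p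

end

end

noncomputable section

/-! ### The Hessian of a sum of powers and a product -/

section

variable {ι : Type*} [Fintype ι] [DecidableEq ι]

/-- The function `y ↦ ∑ j, y j ^ e j + c + b * ∏ j, y j`. -/
def powerSumProd (e : ι → ℕ) (b c : ℂ) (y : ι → ℂ) : ℂ :=
  ∑ j, y j ^ e j + c + b * ∏ j, y j

omit [DecidableEq ι] in
theorem analyticAt_powerSumProd (e : ι → ℕ) (b c : ℂ) (p : ι → ℂ) :
    AnalyticAt ℂ (powerSumProd e b c) p := by
  have h1 : ∀ j, AnalyticAt ℂ (fun y : ι → ℂ => y j) p := fun j =>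
    (ContinuousLinearMap.proj j : (ι → ℂ) →L[ℂ] ℂ).analyticAt p
  exact ((Finset.analyticAt_fun_sum _ fun j _ => (h1 j).pow (e j)).add analyticAt_const).add
    (analyticAt_const.mul (Finset.analyticAt_fun_prod _ fun j _ => h1 j))

theorem hasFDerivAt_prod_apply (y : ι → ℂ) :
    HasFDerivAt (fun y : ι → ℂ => ∏ j, y j)
      (∑ j, (∏ k ∈ Finset.univ.erase j, y k) • (ContinuousLinearMap.proj j : (ι → ℂ) →L[ℂ] ℂ)) y :=
  HasFDerivAt.finsetProd fun j _ => hasFDerivAt_apply j y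

/-- The factor `y j` completes the partial product to `∏ k, y k`, so all the derivatives share the
same second term. -/
theorem mul_fderiv_powerSumProd {e : ι → ℕ} (he : ∀ j, e j ≠ 0) (b c : ℂ) (y : ι → ℂ) (j : ι) :
    y j * fderiv ℂ (powerSumProd e b c) y (Pi.single j 1) = e j * y j ^ e j + b * ∏ k, y k := by
  have h1 : ∀ k, HasFDerivAt (fun y : ι → ℂ => y k ^ e k)
      (((e k : ℂ) * y k ^ (e k - 1)) • (ContinuousLinearMap.proj k : (ι → ℂ) →L[ℂ] ℂ)) y :=
    fun k => by
      have := (hasFDerivAt_apply (𝕜 := ℂ) k y).pow (e k)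
      refine this.congr_fderiv ?_
      ext u
      simp
  have h2 := ((HasFDerivAt.fun_sum fun k (_ : k ∈ Finset.univ) => h1 k).add_const c).add
    ((hasFDerivAt_prod_apply y).const_mul b)
  have h3 : HasFDerivAt (powerSumProd e b c) _ y := h2
  rw [h3.fderiv]
  simp only [add_apply, sum_apply, smul_apply, ContinuousLinearMap.proj_apply, smul_eq_mul,
    Pi.single_apply, mul_ite, mul_one, mul_zero, Finset.sum_ite_eq', Finset.mem_univ, if_true]
  rw [← Finset.mul_prod_erase _ _ (Finset.mem_univ j)]
  obtain ⟨m, hm⟩ := Nat.exists_eq_succ_of_ne_zero (he j)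
  rw [hm, Nat.succ_eq_add_one, Nat.add_sub_cancel, pow_succ]
  ring

theorem fderiv_powerSumProd_eq_zero {e : ι → ℕ} (he : ∀ j, e j ≠ 0) {b : ℂ} (c : ℂ) {p : ι → ℂ}
    (hp : ∀ j, p j ≠ 0) (hcrit : ∀ j, e j * p j ^ e j + b * ∏ k, p k = 0) :
    fderiv ℂ (powerSumProd e b c) p = 0 := by
  apply ContinuousLinearMap.coe_injective
  refine LinearMap.pi_ext' fun j => LinearMap.ext_ring ?_
  have h := mul_fderiv_powerSumProd he b c p j
  rw [hcrit] at h
  exact (mul_eq_zero.1 h).resolve_left (hp j)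

/-- For `u` in the kernel of the Hessian put `S = ∑ u k / p k`. Differentiating the logarithmic
equations along `u` yields `u j / p j = S / e j`; summation gives `S = (∑ 1 / e j) * S`, hence `S =
0` and `u = 0`. -/
theorem injective_fderiv_fderiv_powerSumProd {e : ι → ℕ} (he : ∀ j, e j ≠ 0) {b : ℂ} (c : ℂ)
    {p : ι → ℂ} (hp : ∀ j, p j ≠ 0) (hcrit : ∀ j, e j * p j ^ e j + b * ∏ k, p k = 0)
    (hsum : ∑ j, (e j : ℂ)⁻¹ ≠ 1) :
    Function.Injective (fderiv ℂ (fderiv ℂ (powerSumProd e b c)) p) := by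
  set f := powerSumProd e b c with hf
  have hd := (analyticAt_powerSumProd e b c p).fderiv.differentiableAt.hasFDerivAt
  have h1 := fderiv_powerSumProd_eq_zero he c hp hcrit
  rw [← hf] at hd h1
  refine (injective_iff_map_eq_zero _).2 fun u hu => ?_
  have key : ∀ j, b * (∏ k, p k) * (∑ k, u k / p k) = b * (∏ k, p k) * (e j * (u j / p j)) := by
    intro j
    -- The two sides of `mul_fderiv_powerSumProd` are differentiated separately. Along `u` the left
    -- side contributes 0, because the gradient vanishes at `p` and `u` lies in the kernel of the
    -- Hessian.
    have h2 : HasFDerivAt (fun y : ι → ℂ => y j * fderiv ℂ f y (Pi.single j 1)) _ p :=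
      (hasFDerivAt_apply (𝕜 := ℂ) j p).mul (hd.clm_apply (hasFDerivAt_const (Pi.single j 1) p))
    have h3 : HasFDerivAt (fun y : ι → ℂ => (e j : ℂ) * y j ^ e j + b * ∏ k, y k) _ p :=
      (((hasFDerivAt_apply (𝕜 := ℂ) j p).pow (e j)).const_mul (e j : ℂ)).add
        ((hasFDerivAt_prod_apply p).const_mul b)
    simp_rw [hf, mul_fderiv_powerSumProd he b c, ← hf] at h2
    have h4 := DFunLike.congr_fun (h2.unique h3) u
    simp only [h1, hu, add_apply, sum_apply, smul_apply, ContinuousLinearMap.proj_apply,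
      smul_eq_mul, ContinuousLinearMap.comp_apply, ContinuousLinearMap.flip_apply,
      zero_apply, mul_zero, add_zero, map_zero] at h4
    have h5 : ∑ k, (∏ l ∈ Finset.univ.erase k, p l) * u k = (∏ k, p k) * ∑ k, u k / p k := by
      rw [Finset.mul_sum]
      refine Finset.sum_congr rfl fun k _ => ?_
      rw [← Finset.mul_prod_erase _ _ (Finset.mem_univ k)]
      field_simp [hp k]
    have h6 : p j ^ (e j - 1) = p j ^ e j / p j := by
      obtain ⟨m, hm⟩ := Nat.exists_eq_succ_of_ne_zero (he j)
      rw [hm, Nat.succ_eq_add_one, Nat.add_sub_cancel, pow_succ, mul_div_cancel_right₀ _ (hp j)]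
    rw [h5, nsmul_eq_mul, h6] at h4
    linear_combination -h4 - e j * (u j / p j) * hcrit j
  -- The index `j` only witnesses that `ι` is nonempty: without variables there is no critical
  -- equation and `b` may be 0.
  have hb : ∀ j : ι, b * (∏ k, p k) ≠ 0 := by
    intro j h
    have := hcrit j
    rw [h, add_zero] at this
    exact mul_ne_zero (Nat.cast_ne_zero.2 (he j)) (pow_ne_zero _ (hp j)) this
  have h2 : ∀ j, u j / p j = (e j : ℂ)⁻¹ * ∑ k, u k / p k := fun j => by
    rw [mul_left_cancel₀ (hb j) (key j), inv_mul_cancel_left₀ (Nat.cast_ne_zero.2 (he j))]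
  have h3 : ∑ k, u k / p k = (∑ k, (e k : ℂ)⁻¹) * ∑ k, u k / p k := by
    rw [Finset.sum_mul]
    exact Finset.sum_congr rfl fun j _ => h2 j
  have h4 : ∑ k, u k / p k = 0 := by
    have : (1 - ∑ k, (e k : ℂ)⁻¹) * ∑ k, u k / p k = 0 := by linear_combination h3
    exact (mul_eq_zero.1 this).resolve_left (sub_ne_zero.2 hsum.symm)
  funext j
  have := h2 j
  rw [h4, mul_zero] at this
  exact (div_eq_zero_iff.1 this).resolve_right (hp j)

end

/-! ### Critical points of the family -/

theorem eval_familyPolynomial {n : ℕ} (w : Fin n → ℕ) (a : ℂ) (x : Fin n → ℂ) :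
    MvPolynomial.eval x (familyPolynomial w a) =
      ∑ i, x i ^ ((∑ j, w j) / w i) + a * ∏ i, x i := by
  simp [familyPolynomial]

theorem mul_eval_pderiv_familyPolynomial {n : ℕ} {w : Fin n → ℕ} (he : ∀ i, (∑ j, w j) / w i ≠ 0)
    (a : ℂ) (x : Fin n → ℂ) (i : Fin n) :
    x i * MvPolynomial.eval x (MvPolynomial.pderiv i (familyPolynomial w a)) =
      ((∑ j, w j) / w i : ℕ) * x i ^ ((∑ j, w j) / w i) + a * ∏ i, x i := by
  have h1 : MvPolynomial.pderiv i (∏ k, MvPolynomial.X k : MvPolynomial (Fin n) ℂ) =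
      ∏ k ∈ Finset.univ.erase i, MvPolynomial.X k := by
    have h2 : MvPolynomial.pderiv i
        (∏ k ∈ Finset.univ.erase i, MvPolynomial.X k : MvPolynomial (Fin n) ℂ) = 0 := by
      refine Finset.prod_induction _ (fun q => MvPolynomial.pderiv i q = 0) (fun q r hq hr => ?_)
        MvPolynomial.pderiv_one fun k hk => MvPolynomial.pderiv_X_of_ne (Finset.ne_of_mem_erase hk)
      rw [MvPolynomial.pderiv_mul, hq, hr, zero_mul, mul_zero, add_zero]
    rw [← Finset.mul_prod_erase _ _ (Finset.mem_univ i), MvPolynomial.pderiv_mul, h2,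
      MvPolynomial.pderiv_X_self, one_mul, mul_zero, add_zero]
  rw [familyPolynomial, map_add, MvPolynomial.pderiv_C_mul, h1, map_sum, map_add, map_sum,
    Finset.sum_eq_single i]
  · simp only [MvPolynomial.pderiv_pow, MvPolynomial.pderiv_X_self, map_mul, map_natCast, map_pow,
      MvPolynomial.eval_X, MvPolynomial.eval_C, MvPolynomial.eval_prod, mul_one]
    rw [← Finset.mul_prod_erase _ _ (Finset.mem_univ i)]
    obtain ⟨m, hm⟩ := Nat.exists_eq_succ_of_ne_zero (he i)
    rw [hm, Nat.succ_eq_add_one, Nat.add_sub_cancel, pow_succ]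
    ring
  · intro k _ hk
    simp [MvPolynomial.pderiv_X_of_ne hk]
  · simp

/-- The logarithmic partial derivatives of `F_a` vanish at `x`. -/
def IsCritical {n : ℕ} (w : Fin n → ℕ) (a : ℂ) (x : Fin n → ℂ) : Prop :=
  ∀ i, ((∑ j, w j) / w i : ℕ) * x i ^ ((∑ j, w j) / w i) + a * ∏ i, x i = 0

section

variable {n : ℕ} {w : Fin n → ℕ} {a : ℂ} {x : Fin n → ℂ}

theorem weight_quotient_ne_zero (hpos : ∀ i, 0 < w i) (i : Fin n) : (∑ j, w j) / w i ≠ 0 :=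
  (Nat.div_pos (Finset.single_le_sum (fun _ _ => Nat.zero_le _) (Finset.mem_univ i))
    (hpos i)).ne'

theorem sum_weight_ne_zero (hpos : ∀ i, 0 < w i) (i : Fin n) : ∑ j, w j ≠ 0 := fun h =>
  weight_quotient_ne_zero hpos i (by rw [h, Nat.zero_div])

theorem weight_quotient_inv (hpos : ∀ i, 0 < w i) (hdvd : ∀ i, w i ∣ ∑ j, w j) (i : Fin n) :
    (((∑ j, w j) / w i : ℕ) : ℂ)⁻¹ = (w i : ℂ) / ((∑ j, w j : ℕ) : ℂ) := by
  rw [Nat.cast_div (hdvd i) (Nat.cast_ne_zero.2 (hpos i).ne'), inv_div]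

/-- One vanishing coordinate kills the product, and then each equation kills its own coordinate. -/
theorem IsCritical.apply_ne_zero (hpos : ∀ i, 0 < w i) (h : IsCritical w a x) (hx : x ≠ 0)
    (i : Fin n) : x i ≠ 0 := by
  intro hi
  apply hx
  funext j
  have hj := h j
  rw [Finset.prod_eq_zero (Finset.mem_univ i) hi, mul_zero, add_zero] at hj
  have h1 := (mul_eq_zero.1 hj).resolve_left (Nat.cast_ne_zero.2 (weight_quotient_ne_zero hpos j))
  exact eq_zero_of_pow_eq_zero h1

theorem IsCritical.pow_eq (hpos : ∀ i, 0 < w i) (hdvd : ∀ i, w i ∣ ∑ j, w j)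
    (h : IsCritical w a x) (i : Fin n) :
    x i ^ ((∑ j, w j) / w i) = -((w i : ℂ) / ((∑ j, w j : ℕ) : ℂ)) * (a * ∏ i, x i) := by
  have h1 : (((∑ j, w j) / w i : ℕ) : ℂ) ≠ 0 :=
    Nat.cast_ne_zero.2 (weight_quotient_ne_zero hpos i)
  rw [← weight_quotient_inv hpos hdvd, neg_mul, eq_neg_iff_add_eq_zero]
  have h2 := h i
  field_simp
  linear_combination h2

theorem sum_weight_div (hpos : ∀ i, 0 < w i) (i : Fin n) :
    ∑ i, (w i : ℂ) / ((∑ j, w j : ℕ) : ℂ) = 1 := by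
  rw [← Finset.sum_div, Nat.cast_sum, div_self]
  rw [← Nat.cast_sum]
  exact Nat.cast_ne_zero.2 (sum_weight_ne_zero hpos i)

theorem IsCritical.eval_eq_zero (hpos : ∀ i, 0 < w i) (hdvd : ∀ i, w i ∣ ∑ j, w j)
    (h : IsCritical w a x) (hx : x ≠ 0) :
    MvPolynomial.eval x (familyPolynomial w a) = 0 := by
  obtain ⟨i, -⟩ := Function.ne_iff.1 hx
  rw [eval_familyPolynomial, Finset.sum_congr rfl fun i _ => h.pow_eq hpos hdvd i, ← Finset.sum_mul,
    Finset.sum_neg_distrib, sum_weight_div hpos i]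
  ring

theorem IsCritical.of_smul (hdvd : ∀ i, w i ∣ ∑ j, w j)
    (h : IsCritical w a x) {y : Fin n → ℂ} {t : ℂ} (hy : ∀ i, y i = t ^ w i * x i) :
    IsCritical w a y := by
  intro i
  have h1 : y i ^ ((∑ j, w j) / w i) = t ^ (∑ j, w j) * x i ^ ((∑ j, w j) / w i) := by
    rw [hy, mul_pow, ← pow_mul, Nat.mul_div_cancel' (hdvd i)]
  have h2 : ∏ i, y i = t ^ (∑ j, w j) * ∏ i, x i := by
    simp_rw [hy]
    rw [Finset.prod_mul_distrib, Finset.prod_pow_eq_pow_sum]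
  rw [h1, h2]
  linear_combination t ^ (∑ j, w j) * h i

/-- Criticality is invariant under the weighted action, so it may be tested on any representative.
Since critical points have nonzero coordinates, the factor `x i` in the logarithmic derivative can
be cancelled. -/
theorem mk_mem_singularPoints_iff (hpos : ∀ i, 0 < w i) (hdvd : ∀ i, w i ∣ ∑ j, w j)
    (x : {x : Fin n → ℂ // x ≠ 0}) :
    WeightedProjectiveSpace.mk w x ∈ singularPoints w a ↔ IsCritical w a x.1 := by
  constructor
  · rintro ⟨-, y, hy, hcrit⟩
    obtain ⟨t, ht⟩ := Quotient.exact hy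
    refine IsCritical.of_smul (x := y.1) hdvd (fun i => ?_) ht
    rw [← mul_eval_pderiv_familyPolynomial (weight_quotient_ne_zero hpos), hcrit i, mul_zero]
  · intro h
    refine ⟨⟨x, rfl, h.eval_eq_zero hpos hdvd x.2⟩, x, rfl, fun i => ?_⟩
    have := mul_eval_pderiv_familyPolynomial (weight_quotient_ne_zero hpos) a x.1 i
    rw [h i] at this
    exact (mul_eq_zero.1 this).resolve_left (h.apply_ne_zero hpos x.2 i)

theorem localEquation_eq (i : Fin n) :
    localEquation w a x i = powerSumProd (fun j : {j : Fin n // j ≠ i} => (∑ k, w k) / w j)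
      (a * x i) (x i ^ ((∑ j, w j) / w i)) := by
  funext y
  rw [localEquation, eval_familyPolynomial, powerSumProd, Fintype.sum_eq_add_sum_subtype_ne _ i,
    Fintype.prod_eq_mul_prod_subtype_ne _ i]
  have h : ∀ j : {j : Fin n // j ≠ i},
      (if h : (j : Fin n) = i then x i else y ⟨j, h⟩) = y j := fun j => dif_neg j.2
  simp only [h, dite_true]
  ring

/-- The order of `t` divides every weight. A general monoid is allowed because this serves for
isotropy groups, for roots of unity and for a quotient of `ℂˣ`. -/
theorem eq_one_of_pow_weight_eq_one (hgcd : Finset.univ.gcd w = 1) {M : Type*} [Monoid M] {t : M}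
    (ht : ∀ i, t ^ w i = 1) : t = 1 := by
  rw [← orderOf_eq_one_iff, ← Nat.dvd_one, ← hgcd]
  exact Finset.dvd_gcd fun i _ => orderOf_dvd_of_pow_eq_one (ht i)

theorem IsCritical.hasTrivialIsotropy (hpos : ∀ i, 0 < w i) (hgcd : Finset.univ.gcd w = 1)
    (h : IsCritical w a x) (hx : x ≠ 0) : HasTrivialIsotropy w x := by
  intro t ht
  refine eq_one_of_pow_weight_eq_one hgcd fun i => Units.ext ?_
  rw [Units.val_pow_eq_pow_val, Units.val_one]
  exact mul_right_cancel₀ (h.apply_ne_zero hpos hx i) ((ht i).trans (one_mul _).symm)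

/-- Freezing the `i`-th coordinate removes `w i / d` from a sum of reciprocal exponents equal to 1,
which is what nondegeneracy of the Hessian needs. -/
theorem IsCritical.localEquation_nondegenerate (hpos : ∀ i, 0 < w i)
    (hdvd : ∀ i, w i ∣ ∑ j, w j) (h : IsCritical w a x) (hx : x ≠ 0) (i : Fin n) :
    AnalyticAt ℂ (localEquation w a x i) (slicePoint x i) ∧
      localEquation w a x i (slicePoint x i) = 0 ∧
      fderiv ℂ (localEquation w a x i) (slicePoint x i) = 0 ∧
      Function.Injective (fderiv ℂ (fderiv ℂ (localEquation w a x i)) (slicePoint x i)) := by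
  have h0 : localEquation w a x i (slicePoint x i) = 0 := by
    rw [localEquation, ← h.eval_eq_zero hpos hdvd hx]
    congr 2
    funext j
    by_cases hj : j = i
    · simp [hj]
    · simp [hj, slicePoint]
  have hp : ∀ j, slicePoint x i j ≠ 0 := fun j => h.apply_ne_zero hpos hx j
  obtain ⟨e, he⟩ : ∃ e : {j : Fin n // j ≠ i} → ℕ, e = fun j => (∑ k, w k) / w j.1 := ⟨_, rfl⟩
  have he0 : ∀ j, e j ≠ 0 := by
    rw [he]
    exact fun j => weight_quotient_ne_zero hpos j.1
  have hcrit : ∀ j, e j * slicePoint x i j ^ e j + a * x i * ∏ k, slicePoint x i k = 0 := by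
    rw [he]
    intro j
    rw [← h j, Fintype.prod_eq_mul_prod_subtype_ne x i, mul_assoc]
    rfl
  have hsum : ∑ j, (e j : ℂ)⁻¹ ≠ 1 := by
    rw [he]
    have h1 := sum_weight_div hpos i
    rw [Fintype.sum_eq_add_sum_subtype_ne _ i] at h1
    simp_rw [weight_quotient_inv hpos hdvd]
    intro h2
    rw [h2, add_eq_right, div_eq_zero_iff] at h1
    exact h1.elim (Nat.cast_ne_zero.2 (hpos i).ne')
      (Nat.cast_ne_zero.2 (sum_weight_ne_zero hpos i))
  rw [localEquation_eq, ← he] at h0 ⊢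
  exact ⟨analyticAt_powerSumProd _ _ _ _, h0, fderiv_powerSumProd_eq_zero he0 _ hp hcrit,
    injective_fderiv_fderiv_powerSumProd he0 _ hp hcrit hsum⟩

/-- The singular points of the fibres are ordinary double points. -/
theorem singularPoints_isOrdinaryDoublePoint (hpos : ∀ i, 0 < w i) (hdvd : ∀ i, w i ∣ ∑ j, w j)
    (hgcd : Finset.univ.gcd w = 1) {q : WeightedProjectiveSpace w} (hq : q ∈ singularPoints w a) :
    IsOrdinaryDoublePoint w a q ∧ HasMilnorNumber w a q 1 ∧ HasTjurinaNumber w a q 1 := by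
  have hcrit : ∀ x, WeightedProjectiveSpace.mk w x = q → IsCritical w a x.1 := by
    rintro x rfl
    exact (mk_mem_singularPoints_iff hpos hdvd x).1 hq
  refine ⟨⟨hq.1, fun x hx => ⟨(hcrit x hx).hasTrivialIsotropy hpos hgcd x.2, fun i _ => ?_⟩⟩,
    fun x hx i _ => ?_, fun x hx i _ => ?_⟩
  all_goals
    obtain ⟨h1, h2, h3, h4⟩ := (hcrit x hx).localEquation_nondegenerate hpos hdvd x.2 i
  · exact isLocallySumOfSquares_of_nondegenerate h1 h2 h3 h4
  · exact milnorNumber_eq_one h1 h3 h4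
  · exact tjurinaNumber_eq_one h1 h2 h3 h4

end

end

noncomputable section

/-! ### Counting -/

/-- The fibres of `Φ` are the left cosets of `R`, so `X` is in bijection with `K ⧸ R`. -/
theorem Nat.card_eq_card_mul_card_of_fibres {K X : Type*} [Group K] (R : Subgroup K) (Φ : K → X)
    (hsurj : Function.Surjective Φ) (h : ∀ k k', Φ k = Φ k' ↔ k⁻¹ * k' ∈ R) :
    Nat.card K = Nat.card X * Nat.card R := by
  rw [R.card_eq_card_quotient_mul_card_subgroup]
  congr 1
  refine Nat.card_congr (Equiv.ofBijective
    (fun q : K ⧸ R => Quotient.liftOn' q Φ fun k k' hk =>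
      (h k k').2 (QuotientGroup.leftRel_apply.1 hk)) ⟨?_, fun x => ?_⟩)
  · intro q q'
    induction q using QuotientGroup.induction_on
    induction q' using QuotientGroup.induction_on
    intro hq
    exact QuotientGroup.eq.2 ((h _ _).1 hq)
  · obtain ⟨k, rfl⟩ := hsurj x
    exact ⟨(k : K ⧸ R), rfl⟩

theorem ncard_setOf_pow_eq {d : ℕ} (hd : d ≠ 0) {c : ℂ} (hc : c ≠ 0) :
    {a : ℂ | a ^ d = c}.ncard = d := by
  have : NeZero d := ⟨hd⟩
  have hζ := Complex.isPrimitiveRoot_exp d hd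
  obtain ⟨α, hα⟩ := IsAlgClosed.exists_pow_nat_eq c (Nat.pos_of_ne_zero hd)
  have h1 : {a : ℂ | a ^ d = c} = ((Polynomial.nthRoots d c).toFinset : Set ℂ) := by
    ext a
    simp [Polynomial.mem_nthRoots (Nat.pos_of_ne_zero hd)]
  rw [h1, Set.ncard_coe_finset, Multiset.toFinset_card_of_nodup (hζ.nthRoots_nodup hc),
    hζ.card_nthRoots, if_pos ⟨α, hα⟩]

section

variable {n : ℕ} (w : Fin n → ℕ)

/-- The product of the components of a tuple of roots of unity. -/
def rootsProd : ((i : Fin n) → rootsOfUnity ((∑ j, w j) / w i) ℂ) →* ℂˣ where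
  toFun g := ∏ i, (g i : ℂˣ)
  map_one' := by simp
  map_mul' g h := by simp [Finset.prod_mul_distrib]

variable {w}

theorem rootsProd_apply (g : (i : Fin n) → rootsOfUnity ((∑ j, w j) / w i) ℂ) :
    rootsProd w g = ∏ i, (g i : ℂˣ) :=
  rfl

theorem rootsProd_mem (hdvd : ∀ i, w i ∣ ∑ j, w j)
    (g : (i : Fin n) → rootsOfUnity ((∑ j, w j) / w i) ℂ) :
    rootsProd w g ∈ rootsOfUnity (∑ j, w j) ℂ := by
  rw [rootsProd_apply]
  refine Subgroup.prod_mem _ fun i _ => ?_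
  exact rootsOfUnity_le_of_dvd (Nat.div_dvd_of_dvd (hdvd i)) (g i).2

/-- For a `d`-th root of unity `s`, each `s ^ w i` is a `d / w i`-th root of unity and lies in the
range, as the product of a tuple with one nontrivial entry. So the class of `s` modulo the range is
killed by all weights, hence trivial. -/
theorem range_rootsProd (hdvd : ∀ i, w i ∣ ∑ j, w j) (hgcd : Finset.univ.gcd w = 1) :
    (rootsProd w).range = rootsOfUnity (∑ j, w j) ℂ := by
  apply le_antisymm
  · rintro _ ⟨g, rfl⟩
    exact rootsProd_mem hdvd g
  · intro s hs
    rw [← QuotientGroup.eq_one_iff]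
    refine eq_one_of_pow_weight_eq_one hgcd fun i => ?_
    rw [← QuotientGroup.mk_pow, QuotientGroup.eq_one_iff]
    have h1 : s ^ w i ∈ rootsOfUnity ((∑ j, w j) / w i) ℂ := by
      rw [mem_rootsOfUnity, ← pow_mul, Nat.mul_div_cancel' (hdvd i)]
      exact hs
    refine ⟨Pi.mulSingle i ⟨s ^ w i, h1⟩, ?_⟩
    rw [rootsProd_apply]
    rw [Finset.prod_eq_single i]
    · simp
    · intro j _ hj
      simp [Pi.mulSingle_eq_of_ne hj]
    · simp

/-- The action of the `d`-th roots of unity on weighted coordinates. -/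
def rootsWeight (hdvd : ∀ i, w i ∣ ∑ j, w j) :
    rootsOfUnity (∑ j, w j) ℂ →* (rootsProd w).ker where
  toFun t := ⟨fun i => ⟨(t : ℂˣ) ^ w i, by
    rw [mem_rootsOfUnity, ← pow_mul, Nat.mul_div_cancel' (hdvd i)]
    exact t.2⟩, by
    change ∏ i, (t : ℂˣ) ^ w i = 1
    rw [Finset.prod_pow_eq_pow_sum]
    exact t.2⟩
  map_one' := by
    ext
    simp
  map_mul' s t := by
    ext
    simp [mul_pow]

theorem rootsWeight_injective (hdvd : ∀ i, w i ∣ ∑ j, w j) (hgcd : Finset.univ.gcd w = 1) :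
    Function.Injective (rootsWeight hdvd) := by
  refine (injective_iff_map_eq_one _).2 fun t ht => ?_
  refine eq_one_of_pow_weight_eq_one hgcd fun i => ?_
  have := congrArg (fun k : (rootsProd w).ker => (k.1 i : ℂˣ)) ht
  exact Subtype.ext this

theorem card_rootsProd_ker (hpos : ∀ i, 0 < w i) (hdvd : ∀ i, w i ∣ ∑ j, w j)
    (hgcd : Finset.univ.gcd w = 1) (hd : ∑ j, w j ≠ 0) :
    ∏ i, (∑ j, w j) / w i = (∑ j, w j) * Nat.card (rootsProd w).ker := by
  have h1 : Nat.card ((i : Fin n) → rootsOfUnity ((∑ j, w j) / w i) ℂ) =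
      ∏ i, (∑ j, w j) / w i := by
    rw [Nat.card_pi]
    refine Finset.prod_congr rfl fun i _ => ?_
    have : NeZero ((∑ j, w j) / w i) := ⟨weight_quotient_ne_zero hpos i⟩
    exact Complex.card_rootsOfUnity _
  have : NeZero (∑ j, w j) := ⟨hd⟩
  rw [← h1, (rootsProd w).ker.card_eq_card_quotient_mul_card_subgroup,
    Nat.card_congr (QuotientGroup.quotientKerEquivRange (rootsProd w)).toEquiv,
    range_rootsProd hdvd hgcd, Complex.card_rootsOfUnity]

/-- The gcd of the empty family is 0, which excludes `n = 0`. -/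
theorem nonempty_of_gcd_eq_one (hgcd : Finset.univ.gcd w = 1) : Nonempty (Fin n) := by
  by_contra h
  rw [not_nonempty_iff] at h
  simp at hgcd

theorem prod_pow_sum_eq (hdvd : ∀ i, w i ∣ ∑ j, w j) (x : Fin n → ℂ) :
    (∏ i, x i) ^ (∑ j, w j) = ∏ i, (x i ^ ((∑ j, w j) / w i)) ^ w i := by
  rw [← Finset.prod_pow]
  refine Finset.prod_congr rfl fun i _ => ?_
  rw [← pow_mul, Nat.div_mul_cancel (hdvd i)]

theorem prod_pow_weight (b : ℂ) :
    ∏ i, (-((w i : ℂ) / ((∑ j, w j : ℕ) : ℂ)) * b) ^ w i =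
      (-1) ^ (∑ j, w j) * (∏ i, (w i : ℂ) ^ w i) / ((∑ j, w j : ℕ) : ℂ) ^ (∑ j, w j) *
        b ^ (∑ j, w j) := by
  have h1 : ∀ i, (-((w i : ℂ) / ((∑ j, w j : ℕ) : ℂ)) * b) ^ w i =
      (-1) ^ w i * (w i : ℂ) ^ w i / ((∑ j, w j : ℕ) : ℂ) ^ w i * b ^ w i := fun i => by
    rw [mul_pow, ← neg_one_mul, mul_pow, div_pow, mul_div_assoc]
  simp_rw [h1]
  rw [Finset.prod_mul_distrib, Finset.prod_div_distrib, Finset.prod_mul_distrib]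
  simp_rw [Finset.prod_pow_eq_pow_sum]

theorem mem_familyDiscriminant_iff_exists_isCritical (hpos : ∀ i, 0 < w i)
    (hdvd : ∀ i, w i ∣ ∑ j, w j) {a : ℂ} :
    a ∈ familyDiscriminant w ↔ ∃ x, x ≠ 0 ∧ IsCritical w a x := by
  constructor
  · rintro ⟨q, hq⟩
    obtain ⟨x, rfl⟩ := Quotient.exists_rep q
    exact ⟨x.1, x.2, (mk_mem_singularPoints_iff hpos hdvd x).1 hq⟩
  · rintro ⟨x, hx, h⟩
    exact ⟨_, (mk_mem_singularPoints_iff hpos hdvd ⟨x, hx⟩).2 h⟩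

theorem mem_familyDiscriminant_iff (hpos : ∀ i, 0 < w i) (hdvd : ∀ i, w i ∣ ∑ j, w j)
    (hgcd : Finset.univ.gcd w = 1) {a : ℂ} :
    a ∈ familyDiscriminant w ↔
      (-1) ^ (∑ j, w j) * (∏ i, (w i : ℂ) ^ w i) / ((∑ j, w j : ℕ) : ℂ) ^ (∑ j, w j) *
        a ^ (∑ j, w j) = 1 := by
  have hne := nonempty_of_gcd_eq_one hgcd
  rw [mem_familyDiscriminant_iff_exists_isCritical hpos hdvd]
  constructor
  · rintro ⟨x, hx, h⟩
    have h1 := prod_pow_sum_eq hdvd x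
    simp_rw [h.pow_eq hpos hdvd] at h1
    rw [prod_pow_weight, mul_pow] at h1
    have h2 : (∏ i, x i) ^ (∑ j, w j) ≠ 0 :=
      pow_ne_zero _ (Finset.prod_ne_zero_iff.2 fun i _ => h.apply_ne_zero hpos hx i)
    apply mul_right_cancel₀ h2
    rw [one_mul, mul_assoc]
    exact h1.symm
  · intro ha
    -- These are the critical equations under the normalisation `∏ x = 1`. The hypothesis on `a`
    -- says that `∏ ξ` is a `d`-th root of unity, which a tuple `g` of roots of unity then cancels.
    choose ξ hξ using fun i => IsAlgClosed.exists_pow_nat_eq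
      (-((w i : ℂ) / ((∑ j, w j : ℕ) : ℂ)) * a)
      (Nat.pos_of_ne_zero (weight_quotient_ne_zero hpos i))
    have h1 := prod_pow_sum_eq hdvd ξ
    simp_rw [hξ] at h1
    rw [prod_pow_weight, ha] at h1
    have h2 : ∏ i, ξ i ≠ 0 := by
      intro h
      rw [h, zero_pow (sum_weight_ne_zero hpos hne.some)] at h1
      exact zero_ne_one h1
    have h3 : (Units.mk0 _ h2)⁻¹ ∈ rootsOfUnity (∑ j, w j) ℂ := by
      refine inv_mem ?_
      rw [mem_rootsOfUnity']
      exact h1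
    rw [← range_rootsProd hdvd hgcd] at h3
    obtain ⟨g, hg⟩ := h3
    have h4 : ∏ i, ((g i : ℂˣ) : ℂ) = (∏ i, ξ i)⁻¹ := by
      have := congrArg (Units.val) hg
      rw [Units.val_inv_eq_inv_val, Units.val_mk0] at this
      rw [← this]
      exact (Units.coe_prod _ _).symm
    have h5 : ∏ i, ((g i : ℂˣ) : ℂ) * ξ i = 1 := by
      rw [Finset.prod_mul_distrib, h4, inv_mul_cancel₀ h2]
    refine ⟨fun i => ((g i : ℂˣ) : ℂ) * ξ i, ?_, fun i => ?_⟩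
    · intro h
      rw [Finset.prod_eq_zero (Finset.mem_univ hne.some) (congrFun h hne.some)] at h5
      exact zero_ne_one h5
    · have h6 : ((g i : ℂˣ) : ℂ) ^ ((∑ j, w j) / w i) = 1 := (mem_rootsOfUnity' _ _).1 (g i).2
      have h7 : (((∑ j, w j) / w i : ℕ) : ℂ) ≠ 0 :=
        Nat.cast_ne_zero.2 (weight_quotient_ne_zero hpos i)
      rw [h5, mul_pow, h6, hξ, ← weight_quotient_inv hpos hdvd]
      field_simp
      ring

/-- The number of singular points of a singular fibre. -/
theorem ncard_singularPoints_mul (hpos : ∀ i, 0 < w i) (hdvd : ∀ i, w i ∣ ∑ j, w j)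
    (hgcd : Finset.univ.gcd w = 1) {a : ℂ} (ha : a ∈ familyDiscriminant w) :
    (singularPoints w a).ncard * (∑ j, w j) ^ 2 * ∏ i, w i = (∑ j, w j) ^ n := by
  have hne := nonempty_of_gcd_eq_one hgcd
  have hd := sum_weight_ne_zero hpos hne.some
  obtain ⟨x₀, hx₀, h₀⟩ := (mem_familyDiscriminant_iff_exists_isCritical hpos hdvd).1 ha
  have hx₀i := h₀.apply_ne_zero hpos hx₀
  let pt : (rootsProd w).ker → {x : Fin n → ℂ // x ≠ 0} := fun k =>
    ⟨fun i => ((k.1 i : ℂˣ) : ℂ) * x₀ i, fun h =>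
      mul_ne_zero (Units.ne_zero _) (hx₀i hne.some) (congrFun h hne.some)⟩
  have hprod : ∀ k : (rootsProd w).ker, ∏ i, ((k.1 i : ℂˣ) : ℂ) = 1 := fun k => by
    have := congrArg Units.val k.2
    exact (Units.coe_prod _ _).symm.trans this
  have hpt : ∀ k, IsCritical w a (pt k).1 := fun k i => by
    have h6 : ((k.1 i : ℂˣ) : ℂ) ^ ((∑ j, w j) / w i) = 1 := (mem_rootsOfUnity' _ _).1 (k.1 i).2
    simp only [pt]
    rw [mul_pow, h6, one_mul, Finset.prod_mul_distrib, hprod, one_mul]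
    exact h₀ i
  let Φ : (rootsProd w).ker → singularPoints w a := fun k =>
    ⟨WeightedProjectiveSpace.mk w (pt k), (mk_mem_singularPoints_iff hpos hdvd _).2 (hpt k)⟩
  have hsurj : Function.Surjective Φ := by
    rintro ⟨q, hq⟩
    obtain ⟨x, rfl⟩ := Quotient.exists_rep q
    have hx := (mk_mem_singularPoints_iff hpos hdvd x).1 hq
    have hxi := hx.apply_ne_zero hpos x.2
    have hP : ∏ i, x.1 i ≠ 0 := Finset.prod_ne_zero_iff.2 fun i _ => hxi i
    have hP₀ : ∏ i, x₀ i ≠ 0 := Finset.prod_ne_zero_iff.2 fun i _ => hx₀i i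
    -- The weighted action of `t` multiplies the product of the coordinates by `t ^ d`. This choice
    -- gives `t • x₀` the same product as `x`, so the coordinatewise ratios are roots of unity with
    -- product 1.
    obtain ⟨t, ht⟩ := IsAlgClosed.exists_pow_nat_eq ((∏ i, x.1 i) / ∏ i, x₀ i)
      (Nat.pos_of_ne_zero hd)
    have ht0 : t ≠ 0 := by
      rintro rfl
      rw [zero_pow hd] at ht
      exact div_ne_zero hP hP₀ ht.symm
    have hti : ∀ i, t ^ w i * x₀ i ≠ 0 := fun i => mul_ne_zero (pow_ne_zero _ ht0) (hx₀i i)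
    have hg : ∀ i, Units.mk0 (x.1 i / (t ^ w i * x₀ i)) (div_ne_zero (hxi i) (hti i)) ∈
        rootsOfUnity ((∑ j, w j) / w i) ℂ := fun i => by
      rw [mem_rootsOfUnity', Units.val_mk0, div_pow, mul_pow, ← pow_mul,
        Nat.mul_div_cancel' (hdvd i), ht, div_eq_one_iff_eq]
      · rw [hx.pow_eq hpos hdvd, h₀.pow_eq hpos hdvd]
        field_simp
      · exact mul_ne_zero (div_ne_zero hP hP₀) (pow_ne_zero _ (hx₀i i))
    have hk : (fun i => (⟨_, hg i⟩ : rootsOfUnity ((∑ j, w j) / w i) ℂ)) ∈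
        (rootsProd w).ker := by
      refine Units.ext ?_
      refine (Units.coe_prod _ _).trans ?_
      simp only [Units.val_mk0, Units.val_one]
      rw [Finset.prod_div_distrib, Finset.prod_mul_distrib, Finset.prod_pow_eq_pow_sum, ht,
        div_mul_cancel₀ _ hP₀, div_self hP]
    refine ⟨⟨_, hk⟩, Subtype.ext (Quotient.sound ⟨Units.mk0 t ht0, fun i => ?_⟩)⟩
    have := hti i
    simp only [pt, Units.val_mk0]
    field_simp [hx₀i i]
  -- A scalar `t` relating two of these points must preserve the product of the coordinates, which
  -- forces `t ^ d = 1`.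
  have hfib : ∀ k k', Φ k = Φ k' ↔ k⁻¹ * k' ∈ (rootsWeight hdvd).range := by
    intro k k'
    constructor
    · intro h
      obtain ⟨t, ht⟩ := Quotient.exact (Subtype.ext_iff.1 h)
      have h1 : ∀ i, ((k'.1 i : ℂˣ) : ℂ) = (t : ℂ) ^ w i * ((k.1 i : ℂˣ) : ℂ) := fun i => by
        apply mul_right_cancel₀ (hx₀i i)
        rw [mul_assoc]
        exact ht i
      have h2 : t ∈ rootsOfUnity (∑ j, w j) ℂ := by
        have := hprod k'
        simp_rw [h1] at this
        rwa [Finset.prod_mul_distrib, hprod, mul_one, Finset.prod_pow_eq_pow_sum,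
          ← mem_rootsOfUnity'] at this
      refine ⟨⟨t, h2⟩, ?_⟩
      rw [eq_inv_mul_iff_mul_eq]
      refine Subtype.ext (funext fun i => Subtype.ext (Units.ext ?_))
      rw [h1, mul_comm]
      rfl
    · rintro ⟨t, ht⟩
      rw [eq_inv_mul_iff_mul_eq] at ht
      refine Subtype.ext (Quotient.sound ⟨t, fun i => ?_⟩)
      have h1 : ((k'.1 i : ℂˣ) : ℂ) = ((k.1 i : ℂˣ) : ℂ) * ((t : ℂˣ) : ℂ) ^ w i := by
        rw [← ht]
        rfl
      simp only [pt]
      rw [h1]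
      ring
  have h1 := Nat.card_eq_card_mul_card_of_fibres _ Φ hsurj hfib
  have : NeZero (∑ j, w j) := ⟨hd⟩
  rw [← Nat.card_congr (MonoidHom.ofInjective (rootsWeight_injective hdvd hgcd)).toEquiv,
    Complex.card_rootsOfUnity, Nat.card_coe_set_eq] at h1
  have h2 := card_rootsProd_ker hpos hdvd hgcd hd
  rw [h1] at h2
  have h3 : (∏ i, (∑ j, w j) / w i) * ∏ i, w i = (∑ j, w j) ^ n := by
    rw [← Finset.prod_mul_distrib, Finset.prod_congr rfl fun i _ => Nat.div_mul_cancel (hdvd i)]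
    simp
  rw [← h3, h2]
  ring

end

end

/-! ### The main theorem -/

theorem mainTheorem6 {n : ℕ} (w : Fin n → ℕ) (d : ℕ) (hpos : ∀ i, 0 < w i)
    (hd : d = ∑ i, w i) (hdvd : ∀ i, w i ∣ d) (hgcd : Finset.univ.gcd w = 1) :
    familyDiscriminant w =
        {a : ℂ | a ^ d + (-1) ^ (d - 1) * ((d : ℂ) ^ d / ∏ i, (w i : ℂ) ^ w i) = 0} ∧
      (familyDiscriminant w).ncard = d ∧
      ∀ a ∈ familyDiscriminant w,
        ((singularPoints w a).ncard : ℚ) = (d : ℚ) ^ ((n : ℤ) - 2) / ∏ i, (w i : ℚ) ∧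
        ∀ q ∈ singularPoints w a,
          IsOrdinaryDoublePoint w a q ∧ HasMilnorNumber w a q 1 ∧ HasTjurinaNumber w a q 1 := by
  have hd0 : d ≠ 0 := hd ▸ sum_weight_ne_zero hpos (nonempty_of_gcd_eq_one hgcd).some
  have hW : ∏ i, (w i : ℂ) ^ w i ≠ 0 :=
    Finset.prod_ne_zero_iff.2 fun i _ => pow_ne_zero _ (Nat.cast_ne_zero.2 (hpos i).ne')
  have hdC : (d : ℂ) ^ d ≠ 0 := pow_ne_zero _ (Nat.cast_ne_zero.2 hd0)
  have hone : ((-1 : ℂ) ^ d) ≠ 0 := pow_ne_zero _ (by norm_num)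
  have hset : familyDiscriminant w =
      {a : ℂ | a ^ d = (-1) ^ d * ((d : ℂ) ^ d / ∏ i, (w i : ℂ) ^ w i)} := by
    ext a
    rw [mem_familyDiscriminant_iff hpos (hd ▸ hdvd) hgcd, ← hd, Set.mem_ofPred_eq]
    have hsq : ((-1 : ℂ) ^ d) * (-1) ^ d = 1 := by
      rw [← mul_pow]
      simp
    rw [← mul_right_inj' hone, div_mul_eq_mul_div, ← mul_div_assoc, div_eq_iff hdC,
      ← mul_div_assoc, eq_div_iff hW]
    constructor
    · intro h
      linear_combination h - a ^ d * (∏ i, (w i : ℂ) ^ w i) * hsq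
    · intro h
      linear_combination h + a ^ d * (∏ i, (w i : ℂ) ^ w i) * hsq
  refine ⟨?_, ?_, fun a ha => ⟨?_, fun q hq => ?_⟩⟩
  · rw [hset]
    ext a
    -- As `d ≠ 0`, the natural subtraction in `(-1) ^ (d - 1)` is not truncated.
    obtain ⟨m, rfl⟩ := Nat.exists_eq_succ_of_ne_zero hd0
    simp only [Set.mem_ofPred_eq, Nat.succ_eq_add_one, Nat.add_sub_cancel]
    rw [← sub_eq_zero, pow_succ (-1 : ℂ) m]
    ring_nf
  · rw [hset]
    exact ncard_setOf_pow_eq hd0 (mul_ne_zero hone (div_ne_zero hdC hW))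
  · have h := ncard_singularPoints_mul hpos (hd ▸ hdvd) hgcd ha
    rw [← hd] at h
    have hdQ : (d : ℚ) ≠ 0 := Nat.cast_ne_zero.2 hd0
    have hwQ : ∏ i, (w i : ℚ) ≠ 0 :=
      Finset.prod_ne_zero_iff.2 fun i _ => Nat.cast_ne_zero.2 (hpos i).ne'
    have h' : ((singularPoints w a).ncard : ℚ) * (d : ℚ) ^ 2 * ∏ i, (w i : ℚ) = (d : ℚ) ^ n := by
      exact_mod_cast h
    -- The exponent `n - 2` is an integer because it is `-1` when `n = 1`.
    rw [zpow_sub₀ hdQ, zpow_natCast, ← h', eq_div_iff hwQ, eq_div_iff (zpow_ne_zero _ hdQ),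
      show ((2 : ℤ)) = ((2 : ℕ) : ℤ) from rfl, zpow_natCast]
    ring
  · exact singularPoints_isOrdinaryDoublePoint hpos (hd ▸ hdvd) hgcd hq
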